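/- Throughout, $\log$ denotes the logarithm to base $2$, and $\mathbb N_+$ is the set of positive integers. A source is a probability distribution $P$ on the space of infinite sequences of symbols from $\mathbb N_+$; it is stationary and memoryless if the symbols are independent and identically distributed under $P$. $P^n$ denotes the law of the first $n$ symbols. For $f:\mathbb N_+\to[0,1]$, the envelope class $\Lambda_f$ is the set of stationary memoryless sources $P$ with $P^1\{k\}\le f(k)$ for all $k\in\mathbb N_+$. For a class $\Lambda$ of sources and $\Lambda^n=\{P^n: P\in\Lambda\}$, the minimax redundancy and the minimax regret are $$R^+(\Lambda^n)=\inf_{Q}\ \sup_{P\in\Lambda} D(P^n,Q),\qquad R^*(\Lambda^n)=\inf_{Q}\ \sup_{x\in\mathbb N_+^n}\ \sup_{P\in\Lambda}\log\frac{P^n(x)}{Q(x)},$$ where $Q$ ranges over all probability distributions on $\mathbb N_+^n$ and $D(P^n,Q)=\sum_{x\in\mathbb N_+^n}P^n(x)\log\frac{P^n(x)}{Q(x)}$ is the relative entropy (with $D=+\infty$ if $P^n\not\ll Q$; in the regret, the logarithm is $-\infty$ if $P^n(x)=0$ and $+\infty$ if $P^n(x)>0=Q(x)$). **Theorem.** Let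 $C$ and $\alpha$ be positive real numbers with $C>e^{2\alpha}$, and let $\Lambda=\Lambda_{f}$ be the envelope class associated with $f(k)=\min(1,Ce^{-\alpha k})$. Then there are a sequence $(\varepsilon_n)_{n\ge1}$ of real numbers with $\varepsilon_n\to0$ and a real constant $K$ (both may depend on $\alpha$ and $C$) such that for all $n\ge1$ $$\frac{1}{8\alpha}(\log n)^2\,(1-\varepsilon_n)\ \le\ R^+(\Lambda^n)\ \le\ R^*(\Lambda^n)\ \le\ \frac{1}{2\alpha}(\log n)^2+K .$$ -/

import Mathlib

open MeasureTheory ProbabilityTheory Filter Topology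
open scoped ENNReal

noncomputable section

namespace UniversalCoding

/-- The alphabet `ℕ+` carries the discrete σ-algebra. -/
instance instMeasurableSpacePNat : MeasurableSpace ℕ+ := ⊤

instance instDiscreteMeasurableSpacePNat : DiscreteMeasurableSpace ℕ+ :=
  ⟨fun _ => trivial⟩

/-- The shift on infinite sequences of symbols. -/
def shift (x : ℕ → ℕ+) : ℕ → ℕ+ := fun i => x (i + 1)

/-- A source, i.e. a law on infinite sequences, is stationary if it is shift invariant. -/
def IsStationary (P : Measure (ℕ → ℕ+)) : Prop := P.map shift = P

/-- A source is memoryless if the symbols it emits are independent. -/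
def IsMemoryless (P : Measure (ℕ → ℕ+)) : Prop :=
  iIndepFun (fun (i : ℕ) (x : ℕ → ℕ+) => x i) P

/-- `P^n`: the law of the first `n` symbols of a source. -/
def firstSymbols (P : Measure (ℕ → ℕ+)) (n : ℕ) : Measure (Fin n → ℕ+) :=
  P.map (fun x i => x i)

/-- The envelope class `Λ_f`: the stationary memoryless sources whose first marginal is
dominated pointwise by `f`. -/
def envelopeClass (f : ℕ+ → ℝ) : Set (Measure (ℕ → ℕ+)) :=
  {P | IsProbabilityMeasure P ∧ IsStationary P ∧ IsMemoryless P ∧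
    ∀ k : ℕ+, (P.map (fun x => x 0)).real {k} ≤ f k}

/-- The exponential envelope `k ↦ 1 ∧ C e^{-αk}`. -/
def expEnvelope (α C : ℝ) (k : ℕ+) : ℝ := min 1 (C * Real.exp (-α * (k : ℝ)))

/-- Relative entropy in bits (Mathlib's Kullback-Leibler divergence is in nats). -/
def relEntropy {n : ℕ} (P Q : Measure (Fin n → ℕ+)) : ℝ≥0∞ :=
  InformationTheory.klDiv P Q / ENNReal.ofReal (Real.log 2)

/-- Binary logarithm of an extended nonnegative number: `log 0 = -∞`, `log ∞ = ∞`. -/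
def log2 (a : ℝ≥0∞) : EReal := ENNReal.log a / ((Real.log 2 : ℝ) : EReal)

/-- Minimax redundancy `R⁺(Λ^n) = inf_Q sup_{P ∈ Λ} D(P^n, Q)`, in bits. -/
def minimaxRedundancy (Λ : Set (Measure (ℕ → ℕ+))) (n : ℕ) : ℝ≥0∞ :=
  ⨅ Q : ProbabilityMeasure (Fin n → ℕ+), ⨆ P ∈ Λ,
    relEntropy (firstSymbols P n) (Q : Measure (Fin n → ℕ+))

/-- Minimax regret `R*(Λ^n) = inf_Q sup_x sup_{P ∈ Λ} log (P^n(x) / Q(x))`, in bits.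
The quotient is taken in `[0, ∞]`: it is `∞` if `Q(x) = 0 < P^n(x)`, and `0` (with logarithm
`-∞`, no contribution to the supremum) if `P^n(x) = 0`. -/
def minimaxRegret (Λ : Set (Measure (ℕ → ℕ+))) (n : ℕ) : EReal :=
  ⨅ Q : ProbabilityMeasure (Fin n → ℕ+), ⨆ x : Fin n → ℕ+, ⨆ P ∈ Λ,
    log2 (firstSymbols P n {x} / (Q : Measure (Fin n → ℕ+)) {x})

end UniversalCoding

end

namespace UniversalCoding

section KullbackLeibler

open InformationTheory

lemma measure_le_smul_of_singleton_le {β : Type*} [MeasurableSpace β] [Countable β]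
    [MeasurableSingletonClass β] {P Q : Measure β} {c : ℝ≥0∞}
    (h : ∀ x, P {x} ≤ c * Q {x}) : P ≤ c • Q := by
  refine Measure.le_iff.2 fun s hs => ?_
  rw [← Measure.tsum_indicator_apply_singleton P s hs,
    ← Measure.tsum_indicator_apply_singleton (c • Q) s hs]
  refine ENNReal.tsum_le_tsum fun x => ?_
  by_cases hx : x ∈ s
  · simpa [hx] using h x
  · simp [hx]

lemma rnDeriv_mul_singleton {β : Type*} [MeasurableSpace β]
    [MeasurableSingletonClass β] {P Q : Measure β} [SigmaFinite P] [SigmaFinite Q]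
    (h : P ≪ Q) (x : β) : P.rnDeriv Q x * Q {x} = P {x} := by
  rw [← Measure.setLIntegral_rnDeriv h {x}, lintegral_singleton]

/-- A pointwise bound on the likelihood ratio bounds the relative entropy. -/
lemma klDiv_le_of_singleton_le {β : Type*} [MeasurableSpace β] [Countable β]
    [MeasurableSingletonClass β] {P Q : Measure β} [IsProbabilityMeasure P]
    [IsProbabilityMeasure Q] {c : ℝ}
    (h : ∀ x, P {x} ≤ ENNReal.ofReal (Real.exp c) * Q {x}) :
    0 ≤ c ∧ klDiv P Q ≤ ENNReal.ofReal c := by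
  have hle := measure_le_smul_of_singleton_le h
  have hc : 0 ≤ c := by
    have h1 := hle Set.univ
    simp only [measure_univ, Measure.smul_apply, smul_eq_mul, mul_one] at h1
    rw [ENNReal.one_le_ofReal] at h1
    exact Real.one_le_exp_iff.1 h1
  have hac : P ≪ Q := (Measure.absolutelyContinuous_of_le hle).trans
    (Measure.smul_absolutelyContinuous)
  refine ⟨hc, ?_⟩
  have hbd : ∀ᵐ x ∂Q, klFun (P.rnDeriv Q x).toReal ≤ c * (P.rnDeriv Q x).toReal + 1
      - (P.rnDeriv Q x).toReal := by
    rw [ae_iff_of_countable]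
    intro x hx
    have h1 : P.rnDeriv Q x ≤ ENNReal.ofReal (Real.exp c) := by
      have h2 := h x
      rw [← rnDeriv_mul_singleton hac] at h2
      exact (ENNReal.mul_le_mul_iff_left hx (measure_ne_top _ _)).1 h2
    have h2 : (P.rnDeriv Q x).toReal ≤ Real.exp c :=
      ENNReal.toReal_le_of_le_ofReal (Real.exp_pos _).le h1
    rw [klFun_apply]
    rcases eq_or_lt_of_le (ENNReal.toReal_nonneg (a := P.rnDeriv Q x)) with h0 | h0
    · simp [← h0]
    · have : Real.log (P.rnDeriv Q x).toReal ≤ c := by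
        rwa [Real.log_le_iff_le_exp h0]
      nlinarith
  have hint : Integrable (fun x => (P.rnDeriv Q x).toReal) Q := Measure.integrable_toReal_rnDeriv
  have hint2 : Integrable (fun x => c * (P.rnDeriv Q x).toReal + 1
      - (P.rnDeriv Q x).toReal) Q := ((hint.const_mul c).add (integrable_const 1)).sub hint
  have hk : Integrable (fun x => klFun (P.rnDeriv Q x).toReal) Q := by
    refine hint2.mono' ?_ ?_
    · exact (measurable_klFun.comp (Measure.measurable_rnDeriv P Q).ennreal_toReal
        ).aestronglyMeasurable
    · filter_upwards [hbd] with x hx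
      rw [Real.norm_of_nonneg (klFun_nonneg ENNReal.toReal_nonneg)]
      exact hx
  have hllr := (integrable_klFun_rnDeriv_iff hac).1 hk
  rw [← ENNReal.ofReal_toReal (klDiv_ne_top hac hllr)]
  refine ENNReal.ofReal_le_ofReal ?_
  rw [toReal_klDiv_eq_integral_klFun hac]
  refine (integral_mono_ae hk hint2 hbd).trans_eq ?_
  rw [integral_sub (by exact (hint.const_mul c).add (integrable_const 1)) hint,
    integral_add (hint.const_mul c) (integrable_const 1), integral_const_mul,
    Measure.integral_toReal_rnDeriv hac]
  simp

lemma mul_add_one_sub_exp_le_klFun {r t : ℝ} (hr : 0 ≤ r) : r * t + 1 - Real.exp t ≤ klFun r := by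
  rw [klFun_apply]
  rcases eq_or_lt_of_le hr with h0 | h0
  · simp [← h0, Real.exp_nonneg]
  · have h1 := Real.add_one_le_exp (t - Real.log r)
    rw [Real.exp_sub, Real.exp_log h0, le_div_iff₀ h0] at h1
    nlinarith

/-- If `P` charges `A` while `Q A ≤ 1 / N`, then `D(P, Q) ≥ P(A) log N - 1` (in nats). -/
lemma mul_log_sub_one_le_klDiv {β : Type*} [MeasurableSpace β]
    {P Q : Measure β} [IsProbabilityMeasure P] [IsProbabilityMeasure Q] {A : Set β}
    (hA : MeasurableSet A) {N : ℝ} (hN : 0 < N) (hQ : Q.real A ≤ 1 / N) :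
    ENNReal.ofReal (P.real A * Real.log N - 1) ≤ klDiv P Q := by
  by_cases htop : klDiv P Q = ∞
  · simp [htop]
  obtain ⟨hac, hllr⟩ := klDiv_ne_top_iff.1 htop
  refine ENNReal.ofReal_le_of_le_toReal ?_
  rw [toReal_klDiv_eq_integral_klFun hac]
  have hint : Integrable (fun x => (P.rnDeriv Q x).toReal) Q := Measure.integrable_toReal_rnDeriv
  have hk := (integrable_klFun_rnDeriv_iff hac).2 hllr
  set g : β → ℝ := fun x => A.indicator (fun y => (P.rnDeriv Q y).toReal * Real.log N) x +
    A.indicator (fun _ => 1 - N) x with hg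
  have hi1 : Integrable (A.indicator fun y => (P.rnDeriv Q y).toReal * Real.log N) Q :=
    (hint.mul_const _).indicator hA
  have hi2 : Integrable (A.indicator fun _ : β => 1 - N) Q := (integrable_const _).indicator hA
  have hle : ∀ x, g x ≤ klFun (P.rnDeriv Q x).toReal := by
    intro x
    by_cases hx : x ∈ A
    · have := mul_add_one_sub_exp_le_klFun (t := Real.log N)
        (ENNReal.toReal_nonneg (a := P.rnDeriv Q x))
      rw [Real.exp_log hN] at this
      simp only [hg, hx, Set.indicator_of_mem]
      linarith
    · simpa [hg, hx] using klFun_nonneg (ENNReal.toReal_nonneg (a := P.rnDeriv Q x))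
  have hmono := integral_mono (hi1.add hi2) hk hle
  refine le_trans ?_ hmono
  rw [integral_add' hi1 hi2, integral_indicator hA, integral_indicator hA, integral_mul_const,
    Measure.setIntegral_toReal_rnDeriv hac]
  simp only [integral_const, MeasurableSet.univ, measureReal_restrict_apply, Set.univ_inter,
    smul_eq_mul]
  have h3 : Q.real A * N ≤ 1 := by rwa [le_div_iff₀ hN] at hQ
  have h4 : 0 ≤ Q.real A := measureReal_nonneg
  nlinarith

end KullbackLeibler

section Logarithm

lemma log2_le_coe_iff {a : ℝ≥0∞} {s : ℝ} :
    log2 a ≤ s ↔ a ≤ ENNReal.ofReal (Real.exp (s * Real.log 2)) := by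
  have h2 : 0 < Real.log 2 := Real.log_pos one_lt_two
  rw [log2, EReal.div_le_iff_le_mul (by exact_mod_cast h2) (EReal.coe_ne_top _),
    ← ENNReal.log_le_log_iff, ENNReal.log_ofReal_of_pos (Real.exp_pos _), Real.log_exp,
    ← EReal.coe_mul]
  rw [mul_comm]

lemma log2_eq_bot_imp {a : ℝ≥0∞} (h : log2 a = ⊥) : a = 0 := by
  by_contra h0
  have h1 : ∀ s : ℝ, a ≤ ENNReal.ofReal (Real.exp (s * Real.log 2)) := fun s =>
    log2_le_coe_iff.1 (h ▸ bot_le)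
  have h2 : 0 < Real.log 2 := Real.log_pos one_lt_two
  have h3 := h1 0
  have ht : a ≠ ∞ := ne_top_of_le_ne_top ENNReal.ofReal_ne_top h3
  have ha : 0 < a.toReal := ENNReal.toReal_pos h0 ht
  have h4 := h1 ((Real.log a.toReal - 1) / Real.log 2)
  rw [div_mul_cancel₀ _ h2.ne', Real.exp_sub, Real.exp_log ha] at h4
  have h5 := ENNReal.toReal_le_of_le_ofReal (by positivity) h4
  rw [le_div_iff₀ (Real.exp_pos _)] at h5
  have := Real.add_one_le_exp (1 : ℝ)
  nlinarith

end Logarithm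

section MinimaxBounds

instance isProbabilityMeasure_firstSymbols (P : Measure (ℕ → ℕ+)) [IsProbabilityMeasure P] (n : ℕ) :
    IsProbabilityMeasure (firstSymbols P n) :=
  Measure.isProbabilityMeasure_map
    (measurable_pi_lambda _ fun (i : Fin n) => measurable_pi_apply (i : ℕ)).aemeasurable

lemma coe_relEntropy_le_of_singleton_le {n : ℕ} {P Q : Measure (Fin n → ℕ+)}
    [IsProbabilityMeasure P] [IsProbabilityMeasure Q] {s : ℝ}
    (h : ∀ x, log2 (P {x} / Q {x}) ≤ s) : (relEntropy P Q : EReal) ≤ s := by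
  have h2 : 0 < Real.log 2 := Real.log_pos one_lt_two
  have h1 : ∀ x, P {x} ≤ ENNReal.ofReal (Real.exp (s * Real.log 2)) * Q {x} := by
    intro x
    have h3 := log2_le_coe_iff.1 (h x)
    refine (ENNReal.div_le_iff_le_mul (Or.inr ENNReal.ofReal_ne_top)
      (Or.inl (measure_ne_top _ _))).1 h3
  obtain ⟨h0, hk⟩ := klDiv_le_of_singleton_le h1
  have hs : 0 ≤ s := nonneg_of_mul_nonneg_left h0 h2
  have : relEntropy P Q ≤ ENNReal.ofReal s := by
    rw [relEntropy, ENNReal.div_le_iff (by positivity) ENNReal.ofReal_ne_top,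
      ← ENNReal.ofReal_mul hs]
    exact hk
  refine (EReal.coe_ennreal_le_coe_ennreal_iff.2 this).trans_eq ?_
  rw [EReal.coe_ennreal_ofReal, max_eq_left hs]

theorem minimaxRedundancy_le_minimaxRegret (Λ : Set (Measure (ℕ → ℕ+)))
    (hΛ : ∀ P ∈ Λ, IsProbabilityMeasure P) (hne : Λ.Nonempty) (n : ℕ) :
    (minimaxRedundancy Λ n : EReal) ≤ minimaxRegret Λ n := by
  refine le_iInf fun Q => ?_
  set S : EReal := ⨆ x : Fin n → ℕ+, ⨆ P ∈ Λ,
    log2 (firstSymbols P n {x} / (Q : Measure (Fin n → ℕ+)) {x}) with hS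
  have hle : ∀ P ∈ Λ, ∀ x, log2 (firstSymbols P n {x} / (Q : Measure (Fin n → ℕ+)) {x}) ≤ S :=
    fun P hP x => le_iSup_of_le x (le_iSup₂_of_le P hP le_rfl)
  have hbot : S ≠ ⊥ := by
    intro hb
    obtain ⟨P, hP⟩ := hne
    have := hΛ P hP
    have h0 : ∀ x, firstSymbols P n {x} = 0 := by
      intro x
      have h1 := log2_eq_bot_imp (le_bot_iff.1 (hb ▸ hle P hP x))
      rw [ENNReal.div_eq_zero_iff] at h1
      exact h1.resolve_right (measure_ne_top _ _)
    have h1 : firstSymbols P n = 0 := by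
      refine Measure.ext_of_singleton fun x => ?_
      simpa using h0 x
    exact IsProbabilityMeasure.ne_zero (firstSymbols P n) h1
  clear_value S
  induction S using EReal.rec with
  | bot => exact absurd rfl hbot
  | top => exact le_top
  | coe s =>
    have h1 : ∀ P ∈ Λ, (relEntropy (firstSymbols P n) (Q : Measure (Fin n → ℕ+)) : EReal) ≤ s := by
      intro P hP
      have := hΛ P hP
      exact coe_relEntropy_le_of_singleton_le (hle P hP)
    obtain ⟨P, hP⟩ := hne
    have hs : 0 ≤ s := by
      have h3 : (0 : EReal) ≤ s := (EReal.coe_ennreal_nonneg _).trans (h1 P hP)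
      exact_mod_cast h3
    have h2 : minimaxRedundancy Λ n ≤ ENNReal.ofReal s := by
      refine iInf_le_of_le Q (iSup₂_le fun P hP => ?_)
      rw [← EReal.coe_ennreal_le_coe_ennreal_iff, EReal.coe_ennreal_ofReal, max_eq_left hs]
      exact h1 P hP
    refine (EReal.coe_ennreal_le_coe_ennreal_iff.2 h2).trans_eq ?_
    rw [EReal.coe_ennreal_ofReal, max_eq_left hs]

lemma minimaxRegret_le_of_dominating (Λ : Set (Measure (ℕ → ℕ+))) (n : ℕ)
    (Q : Measure (Fin n → ℕ+)) [hQ : IsProbabilityMeasure Q] {c : ℝ}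
    (h : ∀ P ∈ Λ, ∀ x, firstSymbols P n {x} ≤ ENNReal.ofReal (Real.exp c) * Q {x}) :
    minimaxRegret Λ n ≤ ((c / Real.log 2 : ℝ) : EReal) := by
  have h2 : 0 < Real.log 2 := Real.log_pos one_lt_two
  refine iInf_le_of_le ⟨Q, hQ⟩ (iSup_le fun x => iSup₂_le fun P hP => ?_)
  rw [log2_le_coe_iff, div_mul_cancel₀ _ h2.ne']
  exact ENNReal.div_le_of_le_mul (h P hP x)

/-- Redundancy lower bound from a family of well distinguishable sources. -/
lemma le_minimaxRedundancy_of_disjoint (Λ : Set (Measure (ℕ → ℕ+))) (n : ℕ) {Θ : Type*}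
    [Fintype Θ] [Nonempty Θ] (P : Θ → Measure (ℕ → ℕ+)) [∀ θ, IsProbabilityMeasure (P θ)]
    (hP : ∀ θ, P θ ∈ Λ) (A : Θ → Set (Fin n → ℕ+)) (hA : Pairwise (Function.onFun Disjoint A))
    {δ : ℝ} (hδ : ∀ θ, δ ≤ (firstSymbols (P θ) n).real (A θ)) :
    ENNReal.ofReal ((δ * Real.log (Fintype.card Θ) - 1) / Real.log 2) ≤ minimaxRedundancy Λ n := by
  have h2 : 0 < Real.log 2 := Real.log_pos one_lt_two
  have hN : (0 : ℝ) < Fintype.card Θ := by exact_mod_cast Fintype.card_pos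
  refine le_iInf fun Q => ?_
  have hmeas : ∀ s : Set (Fin n → ℕ+), MeasurableSet s := fun s => s.to_countable.measurableSet
  obtain ⟨θ, hθ⟩ : ∃ θ, (Q : Measure (Fin n → ℕ+)).real (A θ) ≤ 1 / Fintype.card Θ := by
    by_contra! hcon
    have h3 : ∑ θ, (Q : Measure (Fin n → ℕ+)).real (A θ) ≤ 1 := by
      rw [← measureReal_biUnion_finset (fun i _ j _ hij => hA hij) (fun i _ => hmeas _)]
      exact measureReal_le_one
    have h4 : ∑ _θ : Θ, (1 : ℝ) / Fintype.card Θ < ∑ θ, (Q : Measure (Fin n → ℕ+)).real (A θ) :=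
      Finset.sum_lt_sum_of_nonempty Finset.univ_nonempty fun i _ => hcon i
    rw [Finset.sum_const, Finset.card_univ, nsmul_eq_mul, mul_one_div_cancel hN.ne'] at h4
    linarith
  refine le_trans ?_ (le_iSup₂_of_le (P θ) (hP θ) le_rfl)
  rw [relEntropy, ENNReal.ofReal_div_of_pos h2]
  refine ENNReal.div_le_div_right (le_trans (ENNReal.ofReal_le_ofReal ?_)
    (mul_log_sub_one_le_klDiv (hmeas (A θ)) hN hθ)) _
  have : 0 ≤ Real.log (Fintype.card Θ) :=
    Real.log_nonneg (by exact_mod_cast Fintype.card_pos)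
  nlinarith [hδ θ]

end MinimaxBounds

section Sources

lemma measurable_shift : Measurable shift :=
  measurable_pi_lambda _ fun i => measurable_pi_apply (i + 1)

lemma IsStationary.map_eval {P : Measure (ℕ → ℕ+)} (h : IsStationary P) (i : ℕ) :
    P.map (fun x => x i) = P.map (fun x => x 0) := by
  induction i with
  | zero => rfl
  | succ i ih =>
    rw [← ih]
    nth_rewrite 2 [← h]
    rw [Measure.map_map (measurable_pi_apply i) measurable_shift]
    rfl

/-- The law of the first symbols of a stationary memoryless source is a product measure. -/
lemma firstSymbols_eq_pi {P : Measure (ℕ → ℕ+)} [IsProbabilityMeasure P]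
    (hs : IsStationary P) (hm : IsMemoryless P) (n : ℕ) :
    firstSymbols P n = Measure.pi fun _ : Fin n => P.map (fun x => x 0) := by
  have h1 : iIndepFun (fun (i : Fin n) (x : ℕ → ℕ+) => x i) P :=
    iIndepFun.precomp (g := fun i : Fin n => (i : ℕ)) Fin.val_injective hm
  rw [firstSymbols, (iIndepFun_iff_map_fun_eq_pi_map
    (fun i : Fin n => (measurable_pi_apply (i : ℕ)).aemeasurable)).1 h1]
  congr 1
  funext i
  exact hs.map_eval i

lemma exists_probabilityMeasure_singleton {p : ℕ+ → ℝ} (h0 : ∀ k, 0 ≤ p k) (h1 : HasSum p 1) :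
    ∃ ν : Measure ℕ+, IsProbabilityMeasure ν ∧ ∀ k, ν {k} = ENNReal.ofReal (p k) := by
  have hs : ∑' k, ENNReal.ofReal (p k) = 1 := by
    rw [← ENNReal.ofReal_tsum_of_nonneg h0 h1.summable, h1.tsum_eq, ENNReal.ofReal_one]
  let q : PMF ℕ+ := ⟨fun k => ENNReal.ofReal (p k), hs ▸ ENNReal.summable.hasSum⟩
  exact ⟨q.toMeasure, inferInstance, fun k => q.toMeasure_apply_singleton k (.singleton k)⟩

end Sources

section PoissonGrid

lemma pow_mul_exp_neg_le (n : ℕ) {x : ℝ} (hx : 0 ≤ x) :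
    x ^ n * Real.exp (-x) ≤ (n : ℝ) ^ n * Real.exp (-n) := by
  rcases Nat.eq_zero_or_pos n with rfl | hn
  · simpa using hx
  have hn' : (0 : ℝ) < n := by exact_mod_cast hn
  have h1 : (x / n) ^ n ≤ Real.exp (x / n - 1) ^ n := by
    have := Real.add_one_le_exp (x / n - 1)
    gcongr
    linarith
  rw [← Real.exp_nat_mul, div_pow, div_le_iff₀ (by positivity),
    show (n : ℝ) * (x / n - 1) = x - n by field_simp] at h1
  calc x ^ n * Real.exp (-x) ≤ Real.exp (x - n) * (n : ℝ) ^ n * Real.exp (-x) := by gcongr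
    _ = (n : ℝ) ^ n * (Real.exp (x - n) * Real.exp (-x)) := by ring
    _ = (n : ℝ) ^ n * Real.exp (-n) := by rw [← Real.exp_add]; ring_nf

/-- Poisson likelihoods are maximized, up to a constant factor, on the grid of squares. -/
lemma pow_mul_exp_neg_le_grid (j : ℕ) {x : ℝ} (hx : 0 ≤ x) :
    x ^ j * Real.exp (-x) ≤
      Real.exp 4 * ((((j.sqrt : ℝ) + 1) ^ 2) ^ j * Real.exp (-((j.sqrt : ℝ) + 1) ^ 2)) := by
  refine (pow_mul_exp_neg_le j hx).trans ?_
  set s : ℝ := (j.sqrt : ℝ) with hs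
  have hs0 : 0 ≤ s := Nat.cast_nonneg _
  have hl : s ^ 2 ≤ j := by rw [hs]; exact_mod_cast Nat.sqrt_le' j
  have hu : (j : ℝ) ≤ (s + 1) ^ 2 := by
    rw [hs]; exact_mod_cast (Nat.lt_succ_sqrt' j).le
  set μ : ℝ := (s + 1) ^ 2 with hμ
  have hμ0 : 0 < μ := by positivity
  have h1 : ((j : ℝ) / μ) ^ j ≤ Real.exp ((j : ℝ) / μ - 1) ^ j := by
    have := Real.add_one_le_exp ((j : ℝ) / μ - 1)
    gcongr
    linarith
  rw [← Real.exp_nat_mul, div_pow, div_le_iff₀ (by positivity)] at h1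
  have h2 : (j : ℝ) * (j / μ - 1) - j ≤ 4 - μ := by
    have h3 : (μ - j) ^ 2 ≤ 4 * μ := by
      have h4 : μ - j ≤ 2 * (s + 1) := by rw [hμ]; nlinarith
      have h5 : 0 ≤ μ - j := by linarith
      nlinarith [mul_le_mul h4 h4 h5 (by positivity)]
    have h6 : (j : ℝ) * (j / μ - 1) - j + μ = (μ - j) ^ 2 / μ := by field_simp; ring
    have h7 : (μ - j) ^ 2 / μ ≤ 4 := by rwa [div_le_iff₀ hμ0]
    linarith
  calc (j : ℝ) ^ j * Real.exp (-j)
      ≤ Real.exp (j * (j / μ - 1)) * μ ^ j * Real.exp (-j) := by gcongr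
    _ = Real.exp (j * (j / μ - 1) - j) * μ ^ j := by
        rw [sub_eq_add_neg _ (j : ℝ), Real.exp_add]; ring
    _ ≤ Real.exp (4 - μ) * μ ^ j := by gcongr
    _ = Real.exp 4 * (μ ^ j * Real.exp (-μ)) := by
        rw [sub_eq_add_neg, Real.exp_add]; ring

lemma prod_eq_prod_pow_count_mul {n : ℕ} (x : Fin n → ℕ+) (T : Finset ℕ+) (a b : ℕ+ → ℝ) :
    ∏ i, (if x i ∈ T then a (x i) else b (x i)) =
      (∏ k ∈ T, a k ^ (Finset.univ.filter fun i => x i = k).card) *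
        ∏ i, (if x i ∈ T then 1 else b (x i)) := by
  have h1 : ∀ k ∈ T, a k ^ (Finset.univ.filter fun i => x i = k).card =
      ∏ i, if x i = k then a k else 1 := by
    intro k _
    rw [Finset.prod_ite, Finset.prod_const, Finset.prod_const_one, mul_one]
  rw [Finset.prod_congr rfl h1, Finset.prod_comm, ← Finset.prod_mul_distrib]
  refine Finset.prod_congr rfl fun i _ => ?_
  rw [Finset.prod_ite_eq]
  split_ifs <;> simp

/-- Poisson intensities: a square from the grid on the finite set `T`, the rescaled envelope
outside of it. -/
noncomputable def gridWeight {T : Finset ℕ+} {N : ℕ} (g : ℕ+ → ℝ) (s : T → Fin N) (k : ℕ+) : ℝ :=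
  if h : k ∈ T then (((s ⟨k, h⟩ : ℕ) : ℝ) + 1) ^ 2 else g k

/-- The total mass of `gridWeight`. -/
noncomputable def gridMass {T : Finset ℕ+} {N : ℕ} (G : ℝ) (s : T → Fin N) : ℝ :=
  ∑ k : T, (((s k : ℕ) : ℝ) + 1) ^ 2 + G

variable {T : Finset ℕ+} {N : ℕ} {g : ℕ+ → ℝ} {G : ℝ} (s : T → Fin N)

lemma gridWeight_nonneg (hg : ∀ k, 0 ≤ g k) (k : ℕ+) : 0 ≤ gridWeight g s k := by
  unfold gridWeight
  split_ifs
  · positivity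
  · exact hg k

lemma hasSum_gridWeight (hG : HasSum (fun k => if k ∈ T then 0 else g k) G) :
    HasSum (gridWeight g s) (gridMass G s) := by
  have h1 : HasSum (fun k => if h : k ∈ T then (((s ⟨k, h⟩ : ℕ) : ℝ) + 1) ^ 2 else 0)
      (∑ k : T, (((s k : ℕ) : ℝ) + 1) ^ 2) := by
    have h2 := hasSum_sum_of_ne_finset_zero (s := T) (L := .unconditional ℕ+)
      (f := fun k => if h : k ∈ T then (((s ⟨k, h⟩ : ℕ) : ℝ) + 1) ^ 2 else 0)
      (fun k hk => by simp [hk])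
    rw [← Finset.sum_attach] at h2
    convert h2 using 1
    refine Finset.sum_congr rfl fun k _ => ?_
    simp
  refine (h1.add hG).congr_fun ?_
  intro k
  unfold gridWeight
  split_ifs <;> simp

lemma gridMass_pos (hT : T.Nonempty) (hG : 0 ≤ G) : 0 < gridMass G s := by
  have : 0 < ∑ k : T, (((s k : ℕ) : ℝ) + 1) ^ 2 := by
    have : Nonempty T := hT.to_subtype
    exact Finset.sum_pos (fun k _ => by positivity) Finset.univ_nonempty
  unfold gridMass
  linarith

lemma mul_mul_le_of_tilted {a u v b d e₀ e₁ e₂ : ℝ} (ha : 0 ≤ a) (hu : 0 ≤ u) (hb : 0 ≤ b)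
    (hd : 0 ≤ d) (he₂ : 0 ≤ e₂) (h01 : e₀ ≤ e₁) (h : a * e₁ ≤ d * (b * e₂))
    (huv : u ≤ v) : a * u * e₀ ≤ d * e₂ * (b * v) :=
  calc a * u * e₀ ≤ a * u * e₁ := by gcongr
    _ = a * e₁ * u := by ring
    _ ≤ d * (b * e₂) * v := by gcongr
    _ = d * e₂ * (b * v) := by ring

lemma mul_le_of_tilted {z e w t r r' d q v : ℝ} (hz : 0 < z * e) (ht : 0 < t) (hr : 0 ≤ r)
    (hd : 0 ≤ d) (hq : 0 ≤ q) (hrr : r' * r = 1) (h : z * v * e ≤ d * t * q)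
    (hw : w * (t * r') ≤ z * e) (hw0 : 0 ≤ w * (t * r')) : v * w ≤ d * r * q := by
  have hpos : 0 < z * e * t := by positivity
  refine le_of_mul_le_mul_left ?_ hpos
  calc z * e * t * (v * w) = (z * v * e) * (w * (t * r')) * r := by
        linear_combination (-z * e * t * v * w) * hrr
    _ ≤ (d * t * q) * (z * e) * r := by gcongr
    _ = z * e * t * (d * r * q) := by ring

/-- A memoryless likelihood under an envelope is dominated by one on the grid. -/
lemma exists_prod_le_prod_gridWeight {n : ℕ} (hn : 0 < n) (hT : T.Nonempty) {f p : ℕ+ → ℝ}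
    {F : ℝ} (hp0 : ∀ k, 0 ≤ p k) (hpf : ∀ k, p k ≤ f k) (hpT : ∑ k ∈ T, p k ≤ 1)
    (hF : 0 ≤ F) (x : Fin n → ℕ+) :
    ∃ s : T → Fin (n.sqrt + 1), ∏ i, p (x i) ≤ Real.exp (4 * T.card + n * F) *
      ∏ i, (gridWeight (fun k => n * f k) s (x i) / gridMass (n * F) s) := by
  set c : ℕ+ → ℕ := fun k => (Finset.univ.filter fun i => x i = k).card with hc
  have hcn : ∀ k, c k ≤ n := fun k => (Finset.card_le_univ _).trans_eq (Fintype.card_fin n)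
  refine ⟨fun k => ⟨(c k).sqrt, Nat.lt_succ_of_le (Nat.sqrt_le_sqrt (hcn k))⟩, ?_⟩
  set s : T → Fin (n.sqrt + 1) :=
    fun k => ⟨(c k).sqrt, Nat.lt_succ_of_le (Nat.sqrt_le_sqrt (hcn k))⟩ with hs
  set μ : ℕ+ → ℝ := fun k => (((c k).sqrt : ℝ) + 1) ^ 2 with hμ
  have hn' : (0 : ℝ) < n := by exact_mod_cast hn
  have hf0 : ∀ k, 0 ≤ f k := fun k => (hp0 k).trans (hpf k)
  have hM : gridMass (n * F) s = ∑ k ∈ T, μ k + n * F := by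
    rw [gridMass, ← Finset.sum_coe_sort T]
  have hw : ∀ k, gridWeight (fun k => n * f k) s k = if k ∈ T then μ k else n * f k := by
    intro k
    unfold gridWeight
    split_ifs <;> rfl
  have hW : 0 < gridMass (n * F) s := gridMass_pos s hT (by positivity)
  set W := gridMass (n * F) s with hWdef
  have h1 : ∏ i, ((n : ℝ) * p (x i)) = (∏ k ∈ T, (n * p k) ^ c k) *
      ∏ i, (if x i ∈ T then 1 else n * p (x i)) := by
    rw [← prod_eq_prod_pow_count_mul x T (fun k => n * p k) (fun k => n * p k)]
    simp
  have h2 : ∏ i, gridWeight (fun k => n * f k) s (x i) = (∏ k ∈ T, μ k ^ c k) *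
      ∏ i, (if x i ∈ T then 1 else n * f (x i)) := by
    rw [← prod_eq_prod_pow_count_mul x T μ (fun k => n * f k)]
    exact Finset.prod_congr rfl fun i _ => hw _
  have h3 : ∏ k ∈ T, ((n * p k) ^ c k * Real.exp (-(n * p k))) ≤
      ∏ k ∈ T, (Real.exp 4 * (μ k ^ c k * Real.exp (-μ k))) := by
    refine Finset.prod_le_prod (fun k _ => ?_) (fun k _ => ?_)
    · have := hp0 k
      positivity
    · exact pow_mul_exp_neg_le_grid (c k) (mul_nonneg hn'.le (hp0 k))
  rw [Finset.prod_mul_distrib, Finset.prod_mul_distrib, Finset.prod_mul_distrib,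
    Finset.prod_const, ← Real.exp_sum, ← Real.exp_sum, ← Real.exp_nat_mul, Finset.sum_neg_distrib,
    Finset.sum_neg_distrib, ← Finset.mul_sum] at h3
  have h4 : ∏ i, (if x i ∈ T then 1 else n * p (x i)) ≤
      ∏ i, (if x i ∈ T then 1 else n * f (x i)) := by
    refine Finset.prod_le_prod (fun i _ => ?_) (fun i _ => ?_)
    · have := hp0 (x i)
      split_ifs <;> positivity
    · have := hpf (x i)
      split_ifs
      · exact le_rfl
      · gcongr
  have h5 : 0 ≤ ∏ i, (if x i ∈ T then 1 else n * p (x i)) := by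
    refine Finset.prod_nonneg fun i _ => ?_
    have := hp0 (x i)
    split_ifs <;> positivity
  have hA : 0 ≤ ∏ k ∈ T, (n * p k) ^ c k :=
    Finset.prod_nonneg fun k _ => by have := hp0 k; positivity
  have hB : 0 ≤ ∏ k ∈ T, μ k ^ c k := Finset.prod_nonneg fun k _ => by positivity
  have h6 : (n : ℝ) ^ n * (∏ i, p (x i)) * Real.exp (-n) ≤
      Real.exp (T.card * 4) * Real.exp (-∑ k ∈ T, μ k) *
        ∏ i, gridWeight (fun k => n * f k) s (x i) := by
    have h7 : (n : ℝ) ^ n * ∏ i, p (x i) = ∏ i, ((n : ℝ) * p (x i)) := by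
      rw [Finset.prod_mul_distrib]; simp
    have h8 : Real.exp (-(n : ℝ)) ≤ Real.exp (-(n * ∑ k ∈ T, p k)) := by
      apply Real.exp_le_exp.2
      nlinarith
    rw [h7, h1, h2]
    exact mul_mul_le_of_tilted hA h5 hB (Real.exp_pos _).le (Real.exp_pos _).le
      h8 h3 h4
  have h9 := pow_mul_exp_neg_le n hW.le
  have hP : 0 ≤ ∏ i, gridWeight (fun k => n * f k) s (x i) :=
    Finset.prod_nonneg fun i _ => gridWeight_nonneg s (fun k => mul_nonneg hn'.le (hf0 k)) _
  rw [Finset.prod_div_distrib, Finset.prod_const, Finset.card_univ, Fintype.card_fin,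
    ← mul_div_assoc, le_div_iff₀ (by positivity)]
  have h10 : Real.exp (-W) = Real.exp (-∑ k ∈ T, μ k) * Real.exp (-(n * F)) := by
    rw [hM, ← Real.exp_add]; ring_nf
  rw [h10] at h9
  have hp : 0 ≤ ∏ i, p (x i) := Finset.prod_nonneg fun i _ => hp0 _
  rw [Real.exp_add, mul_comm 4]
  refine mul_le_of_tilted (by positivity) (Real.exp_pos (-∑ k ∈ T, μ k)) (Real.exp_pos _).le
    (Real.exp_pos _).le hP ?_ h6 h9 (by positivity)
  rw [← Real.exp_add]
  simp

end PoissonGrid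

section RegretBound

/-- Regret bound for an envelope class, by a uniform mixture of memoryless sources. -/
theorem minimaxRegret_envelopeClass_le {f : ℕ+ → ℝ} {n : ℕ} (hn : 0 < n) {h : ℕ+ → ℝ}
    (hfh : ∀ k, f k ≤ h k) (h0 : ∀ k, 0 ≤ h k) {T : Finset ℕ+} (hT : T.Nonempty) {F : ℝ}
    (hF : HasSum (fun k => if k ∈ T then 0 else h k) F) :
    minimaxRegret (envelopeClass f) n ≤
      (((4 * T.card + n * F + T.card * Real.log (n.sqrt + 1)) / Real.log 2 : ℝ) : EReal) := by
  have hF0 : 0 ≤ F := hF.nonneg fun k => by split_ifs <;> simp [h0]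
  have hn' : (0 : ℝ) < n := by exact_mod_cast hn
  have hsum : HasSum (fun k => if k ∈ T then 0 else (n : ℝ) * h k) (n * F) := by
    have := hF.mul_left (n : ℝ)
    simpa only [mul_ite, mul_zero] using this
  have hν : ∀ s : T → Fin (n.sqrt + 1), ∃ ν : Measure ℕ+, IsProbabilityMeasure ν ∧
      ∀ k, ν {k} = ENNReal.ofReal (gridWeight (fun k => n * h k) s k / gridMass (n * F) s) := by
    intro s
    have hpos : 0 < gridMass (n * F) s := gridMass_pos s hT (by positivity)
    refine exists_probabilityMeasure_singleton (fun k => div_nonneg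
      (gridWeight_nonneg s (fun k => mul_nonneg hn'.le (h0 k)) k) hpos.le) ?_
    have := (hasSum_gridWeight s hsum).div_const (gridMass (n * F) s)
    rwa [div_self hpos.ne'] at this
  choose ν hνp hνs using hν
  set c : ℝ≥0∞ := (Fintype.card (T → Fin (n.sqrt + 1)) : ℝ≥0∞) with hc
  have hcard : (Fintype.card (T → Fin (n.sqrt + 1)) : ℝ) =
      Real.exp (T.card * Real.log (n.sqrt + 1)) := by
    rw [Real.exp_nat_mul, Real.exp_log (by positivity)]
    simp
  have hc' : c = ENNReal.ofReal (Real.exp (T.card * Real.log (n.sqrt + 1))) := by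
    rw [← hcard, ENNReal.ofReal_natCast]
  have hc0 : c ≠ 0 := by
    rw [hc']; exact (ENNReal.ofReal_pos.2 (Real.exp_pos _)).ne'
  have hct : c ≠ ∞ := by rw [hc']; exact ENNReal.ofReal_ne_top
  set Q : Measure (Fin n → ℕ+) := c⁻¹ • ∑ s, Measure.pi fun _ : Fin n => ν s with hQ
  have hQp : IsProbabilityMeasure Q := by
    refine ⟨?_⟩
    rw [hQ, Measure.smul_apply, Measure.finsetSum_apply]
    simp only [measure_univ, Finset.sum_const, Finset.card_univ, nsmul_eq_mul, mul_one,
      smul_eq_mul]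
    exact ENNReal.inv_mul_cancel hc0 hct
  refine minimaxRegret_le_of_dominating _ n Q ?_
  rintro P ⟨hP, hs, hm, hPf⟩ x
  have hmap : IsProbabilityMeasure (P.map fun x => x 0) :=
    Measure.isProbabilityMeasure_map (measurable_pi_apply 0).aemeasurable
  obtain ⟨s, hle⟩ := exists_prod_le_prod_gridWeight hn hT
    (p := fun k => (P.map fun x => x 0).real {k}) (f := h) (fun k => measureReal_nonneg)
    (fun k => (hPf k).trans (hfh k)) (by
      rw [← measureReal_biUnion_finset (fun i _ j _ hij => by simpa using hij)
        (fun i _ => .singleton i)]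
      exact measureReal_le_one) hF0 x
  have h1 : firstSymbols P n {x} =
      ENNReal.ofReal (∏ i, (P.map fun x => x 0).real {x i}) := by
    rw [firstSymbols_eq_pi hs hm, Measure.pi_singleton,
      ENNReal.ofReal_prod_of_nonneg fun i _ => measureReal_nonneg]
    exact Finset.prod_congr rfl fun i _ => (ofReal_measureReal).symm
  have h2 : (Measure.pi fun _ : Fin n => ν s) {x} = ENNReal.ofReal
      (∏ i, (gridWeight (fun k => n * h k) s (x i) / gridMass (n * F) s)) := by
    rw [Measure.pi_singleton, ENNReal.ofReal_prod_of_nonneg]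
    · exact Finset.prod_congr rfl fun i _ => hνs s (x i)
    · exact fun i _ => div_nonneg (gridWeight_nonneg s (fun k => mul_nonneg hn'.le (h0 k)) _)
        (gridMass_pos s hT (by positivity)).le
  have h3 : (Measure.pi fun _ : Fin n => ν s) {x} ≤ c * Q {x} := by
    rw [hQ, Measure.smul_apply, smul_eq_mul, ← mul_assoc, ENNReal.mul_inv_cancel hc0 hct, one_mul,
      Measure.finsetSum_apply]
    exact Finset.single_le_sum (f := fun s => (Measure.pi fun _ : Fin n => ν s) {x})
      (fun _ _ => zero_le) (Finset.mem_univ s)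
  calc firstSymbols P n {x}
      ≤ ENNReal.ofReal (Real.exp (4 * T.card + n * F)) * (Measure.pi fun _ : Fin n => ν s) {x} := by
        rw [h1, h2, ← ENNReal.ofReal_mul (Real.exp_pos _).le]
        exact ENNReal.ofReal_le_ofReal hle
    _ ≤ ENNReal.ofReal (Real.exp (4 * T.card + n * F)) * (c * Q {x}) := by gcongr
    _ = _ := by
        rw [← mul_assoc, hc', ← ENNReal.ofReal_mul (Real.exp_pos _).le, ← Real.exp_add]

lemma hasSum_exp_tail {α : ℝ} (hα : 0 < α) (C : ℝ) (m : ℕ+) :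
    HasSum (fun k : ℕ+ => if k ∈ Finset.Icc 1 m then 0 else C * Real.exp (-α * (k : ℝ)))
      (C * Real.exp (-α * (m + 1)) / (1 - Real.exp (-α))) := by
  have h1 : HasSum (fun k : ℕ => if k + 1 ≤ (m : ℕ) then 0 else
      C * Real.exp (-α * ((k + 1 : ℕ) : ℝ))) (C * Real.exp (-α * (m + 1)) / (1 - Real.exp (-α))) := by
    rw [← hasSum_nat_add_iff' (m : ℕ)]
    have h2 := (hasSum_geometric_of_lt_one (Real.exp_pos (-α)).le
      (Real.exp_lt_one_iff.2 (by linarith))).mul_left (C * Real.exp (-α * (m + 1)))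
    convert! h2 using 1
    · funext k
      rw [if_neg (by omega), mul_assoc, ← Real.exp_nat_mul, ← Real.exp_add]
      push_cast
      ring_nf
    · rw [Finset.sum_eq_zero, sub_zero, div_eq_mul_inv]
      intro k hk
      rw [if_pos (by simpa using hk)]
  refine (hasSum_pnat_iff_hasSum_succ
    (f := fun k : ℕ => if k ≤ (m : ℕ) then 0 else C * Real.exp (-α * (k : ℝ)))).2 h1 |>.congr_fun ?_
  intro k
  simp

lemma exists_quadratic_bound {α B : ℝ} (hα : 0 < α) :
    ∃ K : ℝ, ∀ x : ℝ, ((x / α + 2) * (5 + x / 2) + B) / Real.log 2 ≤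
      1 / (2 * α) * (x / Real.log 2) ^ 2 + K := by
  have h2 : 0 < Real.log 2 := Real.log_pos one_lt_two
  have h2' : Real.log 2 < 1 := Real.log_two_lt_d9.trans (by norm_num)
  set l := Real.log 2 with hl
  set a : ℝ := (1 - l) / (2 * α) with ha
  have ha0 : 0 < a := div_pos (by linarith) (by positivity)
  set b : ℝ := (5 / α + 1) * l with hb
  refine ⟨((10 + B) * l + b ^ 2 / (4 * a)) / l ^ 2, fun x => ?_⟩
  have h3 : b * x ≤ a * x ^ 2 + b ^ 2 / (4 * a) := by
    have : a * x ^ 2 + b ^ 2 / (4 * a) - b * x = (2 * a * x - b) ^ 2 / (4 * a) := by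
      field_simp; ring
    have h4 : 0 ≤ (2 * a * x - b) ^ 2 / (4 * a) := by positivity
    linarith
  have h5 : ((x / α + 2) * (5 + x / 2) + B) * l = 1 / (2 * α) * x ^ 2 - a * x ^ 2 + b * x +
      (10 + B) * l := by
    rw [ha, hb]; field_simp; ring
  have h6 : ((x / α + 2) * (5 + x / 2) + B) / l = (((x / α + 2) * (5 + x / 2) + B) * l) / l ^ 2 := by
    field_simp
  have h7 : 1 / (2 * α) * (x / l) ^ 2 + ((10 + B) * l + b ^ 2 / (4 * a)) / l ^ 2 =
      (1 / (2 * α) * x ^ 2 + ((10 + B) * l + b ^ 2 / (4 * a))) / l ^ 2 := by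
    rw [div_pow]; ring
  rw [h6, h7]
  gcongr
  linarith

theorem exists_minimaxRegret_le {α C : ℝ} (hα : 0 < α) (hC : 0 < C) :
    ∃ K : ℝ, ∀ n : ℕ, 1 ≤ n → minimaxRegret (envelopeClass (expEnvelope α C)) n ≤
        ((1 / (2 * α) * Real.logb 2 n ^ 2 + K : ℝ) : EReal) := by
  have hd : 0 < 1 - Real.exp (-α) := sub_pos.2 (Real.exp_lt_one_iff.2 (by linarith))
  obtain ⟨K, hK⟩ := exists_quadratic_bound (B := C / (1 - Real.exp (-α))) hα
  refine ⟨K, fun n hn => ?_⟩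
  have hn' : (1 : ℝ) ≤ n := by exact_mod_cast hn
  have hx : 0 ≤ Real.log n := Real.log_nonneg hn'
  set m : ℕ+ := Nat.succPNat ⌈Real.log n / α⌉₊ with hm
  have hm1 : Real.log n / α ≤ m := by
    rw [hm, Nat.succPNat_coe, Nat.succ_eq_add_one]
    push_cast
    linarith [Nat.le_ceil (Real.log n / α)]
  have hm2 : (m : ℝ) ≤ Real.log n / α + 2 := by
    rw [hm, Nat.succPNat_coe, Nat.succ_eq_add_one]
    push_cast
    linarith [Nat.ceil_lt_add_one (div_nonneg hx hα.le)]
  have h1 := minimaxRegret_envelopeClass_le (f := expEnvelope α C)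
    (h := fun k => C * Real.exp (-α * (k : ℝ))) (T := Finset.Icc 1 m) hn (fun k => min_le_right _ _)
    (fun k => by positivity) ⟨1, by simp⟩ (hasSum_exp_tail hα C m)
  refine h1.trans ?_
  rw [EReal.coe_le_coe_iff]
  refine le_trans ?_ (hK (Real.log n))
  have hcard : ((Finset.Icc 1 m).card : ℝ) = m := by simp
  rw [hcard]
  have hlog : Real.log ((n.sqrt : ℝ) + 1) ≤ 1 + Real.log n / 2 := by
    have h3 : (n.sqrt : ℝ) + 1 ≤ 2 * Real.sqrt n := by
      have h4 := Real.nat_sqrt_le_real_sqrt (a := n)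
      have h5 : 1 ≤ Real.sqrt n := Real.one_le_sqrt.2 hn'
      linarith
    have h6 := Real.log_le_log (by positivity) h3
    rw [Real.log_mul two_ne_zero (by positivity), Real.log_sqrt (by positivity)] at h6
    linarith [Real.log_two_lt_d9]
  have hF : (n : ℝ) * (C * Real.exp (-α * (m + 1)) / (1 - Real.exp (-α))) ≤
      C / (1 - Real.exp (-α)) := by
    rw [← mul_div_assoc]
    gcongr
    have h3 : Real.exp (-α * (m + 1)) ≤ Real.exp (-Real.log n) := by
      apply Real.exp_le_exp.2
      rw [div_le_iff₀ hα] at hm1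
      linarith
    rw [Real.exp_neg, Real.exp_log (by positivity)] at h3
    calc (n : ℝ) * (C * Real.exp (-α * (m + 1))) ≤ n * (C * (n : ℝ)⁻¹) := by gcongr
      _ = C := by field_simp
  have hm0 : (0 : ℝ) ≤ m := by positivity
  have h7 : 4 * (m : ℝ) + m * Real.log ((n.sqrt : ℝ) + 1) ≤
      (Real.log n / α + 2) * (5 + Real.log n / 2) := by
    calc _ = (m : ℝ) * (4 + Real.log ((n.sqrt : ℝ) + 1)) := by ring
      _ ≤ (m : ℝ) * (5 + Real.log n / 2) := mul_le_mul_of_nonneg_left (by linarith) hm0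
      _ ≤ _ := by gcongr
  have h2 : 0 < Real.log 2 := Real.log_pos one_lt_two
  refine div_le_div_of_nonneg_right ?_ h2.le
  linarith

end RegretBound

section MemorylessSources

lemma infinitePi_mem_envelopeClass {f : ℕ+ → ℝ} {ν : Measure ℕ+} [IsProbabilityMeasure ν]
    (h : ∀ k, ν.real {k} ≤ f k) :
    Measure.infinitePi (fun _ : ℕ => ν) ∈ envelopeClass f := by
  refine ⟨inferInstance, ?_, ?_, fun k => ?_⟩
  · exact Measure.map_infinitePi_infinitePi_of_inj (P := fun _ : ℕ => ν) (f := fun i : ℕ => i + 1)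
      (add_left_injective 1)
  · exact iIndepFun_infinitePi (P := fun _ : ℕ => ν) (X := fun _ ω => ω) fun _ => measurable_id
  · rw [Measure.infinitePi_map_eval (fun _ : ℕ => ν)]
    exact h k

lemma firstSymbols_infinitePi (ν : Measure ℕ+) [IsProbabilityMeasure ν] (n : ℕ) :
    firstSymbols (Measure.infinitePi fun _ : ℕ => ν) n = Measure.pi fun _ => ν := by
  rw [firstSymbols, ← Measure.infinitePi_eq_pi]
  exact Measure.map_infinitePi_infinitePi_of_inj (P := fun _ : ℕ => ν)
    (f := fun i : Fin n => (i : ℕ)) Fin.val_injective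

/-- The number of occurrences of a symbol in a word. -/
noncomputable def symbolCount {n : ℕ} (k : ℕ+) (x : Fin n → ℕ+) : ℝ :=
  ∑ i, ({k} : Set ℕ+).indicator (fun _ => (1 : ℝ)) (x i)

/-- Chebyshev's inequality for the number of occurrences of a symbol. -/
lemma measureReal_symbolCount_deviation_le (ν : Measure ℕ+) [IsProbabilityMeasure ν] (n : ℕ)
    (k : ℕ+) {d : ℝ} (hd : 0 < d) :
    (Measure.pi fun _ : Fin n => ν).real {x | d ≤ |symbolCount k x - n * ν.real {k}|} ≤
      n * ν.real {k} / d ^ 2 := by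
  set X : ℕ+ → ℝ := ({k} : Set ℕ+).indicator (fun _ => (1 : ℝ)) with hX
  have hXm : Measurable X := measurable_from_top
  have hXb : ∀ y, ‖X y‖ ≤ 1 := by
    intro y
    rw [hX]
    by_cases h : y = k <;> simp [h]
  have hL : MemLp X 2 ν := MemLp.of_bound hXm.aestronglyMeasurable 1 (.of_forall hXb)
  have hE : ∫ y, X y ∂ν = ν.real {k} := integral_indicator_one (.singleton k)
  have hV : Var[X; ν] ≤ ν.real {k} := by
    refine (variance_le_expectation_sq hXm.aestronglyMeasurable).trans_eq ?_
    rw [← hE]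
    congr 1
    funext y
    by_cases h : y = k <;> simp [hX, h]
  have hLi : ∀ i : Fin n, MemLp (fun x : Fin n → ℕ+ => X (x i)) 2 (Measure.pi fun _ => ν) :=
    fun i => hL.comp_measurePreserving (measurePreserving_eval (fun _ : Fin n => ν) i)
  have hLs : MemLp (∑ i : Fin n, fun x : Fin n → ℕ+ => X (x i)) 2 (Measure.pi fun _ => ν) :=
    memLp_finsetSum' _ fun i _ => hLi i
  have hEs : (Measure.pi fun _ : Fin n => ν)[∑ i : Fin n, fun x : Fin n → ℕ+ => X (x i)] =
      n * ν.real {k} := by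
    simp only [Finset.sum_apply]
    rw [integral_finsetSum _ fun i _ => (hLi i).integrable one_le_two]
    have : ∀ i : Fin n, ∫ x : Fin n → ℕ+, X (x i) ∂(Measure.pi fun _ => ν) = ν.real {k} := by
      intro i
      rw [integral_comp_eval (μ := fun _ : Fin n => ν) hXm.aestronglyMeasurable, hE]
    simp [this]
  have hVs : Var[∑ i : Fin n, fun x : Fin n → ℕ+ => X (x i); Measure.pi fun _ => ν] ≤
      n * ν.real {k} := by
    rw [variance_sum_pi fun _ => hL]
    simpa using mul_le_mul_of_nonneg_left hV (Nat.cast_nonneg n)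
  have h1 := meas_ge_le_variance_div_sq hLs hd
  rw [hEs] at h1
  have h2 := ENNReal.toReal_mono ENNReal.ofReal_ne_top h1
  rw [ENNReal.toReal_ofReal (div_nonneg (variance_nonneg _ _) (sq_nonneg d))] at h2
  refine le_trans (le_of_eq ?_) (h2.trans (by gcongr))
  simp only [Finset.sum_apply]
  rfl

end MemorylessSources

section Packing

variable {T : Finset ℕ+}

/-- Symbol frequencies equal to `q` on `T`, the remaining mass being put on the symbol `1`. -/
noncomputable def spreadFreq (q : T → ℝ) (k : ℕ+) : ℝ :=
  if k = 1 then 1 - ∑ k, q k else if h : k ∈ T then q ⟨k, h⟩ else 0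

lemma spreadFreq_of_mem (h1 : 1 ∉ T) (q : T → ℝ) (k : T) : spreadFreq q k = q k := by
  have : (k : ℕ+) ≠ 1 := fun h => h1 (h ▸ k.2)
  simp [spreadFreq, this]

lemma hasSum_spreadFreq (h1 : 1 ∉ T) (q : T → ℝ) : HasSum (spreadFreq q) 1 := by
  have h2 := hasSum_sum_of_ne_finset_zero (s := insert 1 T) (L := .unconditional ℕ+)
    (f := spreadFreq q) (fun k hk => by
      simp only [Finset.mem_insert, not_or] at hk
      simp [spreadFreq, hk.1, hk.2])
  rw [Finset.sum_insert h1, ← Finset.sum_coe_sort T,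
    Finset.sum_congr rfl fun k _ => spreadFreq_of_mem h1 q k] at h2
  convert h2 using 1
  simp [spreadFreq]

/-- Sources with prescribed frequencies on `T`, below the envelope. -/
lemma exists_source_of_freq (h1 : 1 ∉ T) {f : ℕ+ → ℝ} (hf0 : ∀ k, 0 ≤ f k) (hf1 : 1 ≤ f 1)
    {q : T → ℝ} (hq0 : ∀ k, 0 ≤ q k) (hqf : ∀ k, q k ≤ f k) (hq1 : ∑ k, q k ≤ 1) :
    ∃ ν : Measure ℕ+, IsProbabilityMeasure ν ∧ (∀ k : T, ν.real {(k : ℕ+)} = q k) ∧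
      Measure.infinitePi (fun _ : ℕ => ν) ∈ envelopeClass f := by
  have hp0 : ∀ k, 0 ≤ spreadFreq q k := by
    intro k
    unfold spreadFreq
    split_ifs
    · linarith
    · exact hq0 _
    · exact le_rfl
  obtain ⟨ν, hν, hνs⟩ := exists_probabilityMeasure_singleton hp0 (hasSum_spreadFreq h1 q)
  have hνr : ∀ k, ν.real {k} = spreadFreq q k := fun k => by
    rw [measureReal_def, hνs, ENNReal.toReal_ofReal (hp0 k)]
  refine ⟨ν, hν, fun k => by rw [hνr, spreadFreq_of_mem h1], infinitePi_mem_envelopeClass ?_⟩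
  intro k
  rw [hνr, spreadFreq]
  split_ifs with h h'
  · rw [h]
    linarith [Finset.sum_nonneg fun k (_ : k ∈ Finset.univ) => hq0 k]
  · exact hqf ⟨k, h'⟩
  · exact hf0 k

/-- Words whose symbol counts on `T` are close to prescribed centers. -/
def countBox (n : ℕ) (r D : T → ℝ) : Set (Fin n → ℕ+) :=
  {x | ∀ k : T, |symbolCount (k : ℕ+) x - r k| < D k / 2}

lemma disjoint_countBox {n : ℕ} {r r' D : T → ℝ} {k : T} (h : D k ≤ |r k - r' k|) :
    Disjoint (countBox n r D) (countBox n r' D) := by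
  rw [Set.disjoint_left]
  intro x hx hx'
  have h1 := hx k
  have h2 := hx' k
  have h3 := abs_sub_le (r k) (symbolCount (k : ℕ+) x) (r' k)
  rw [abs_sub_comm (r k) (symbolCount (k : ℕ+) x)] at h3
  linarith

lemma measureReal_countBox_ge (ν : Measure ℕ+) [IsProbabilityMeasure ν] (n : ℕ) {D l : T → ℝ}
    {L : ℝ} (hL : 10 * T.card ≤ L) (hL0 : 0 < L) (hD : ∀ k, D k ^ 2 = 4 * l k * L)
    (hD0 : ∀ k, 0 < D k) (hl : ∀ k : T, n * ν.real {(k : ℕ+)} ≤ l k) :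
    9 / 10 ≤ (Measure.pi fun _ : Fin n => ν).real
      (countBox n (fun k : T => n * ν.real {(k : ℕ+)}) D) := by
  set A := countBox n (fun k : T => n * ν.real {(k : ℕ+)}) D with hA
  have hmeas : MeasurableSet A := A.to_countable.measurableSet
  have hsub : Aᶜ ⊆ ⋃ k ∈ (Finset.univ : Finset T),
      {x | D k / 2 ≤ |symbolCount (k : ℕ+) x - n * ν.real {(k : ℕ+)}|} := by
    intro x hx
    simp only [hA, countBox, Set.mem_compl_iff, Set.mem_ofPred_eq, not_forall, not_lt] at hx
    simpa using hx
  have h1 : (Measure.pi fun _ : Fin n => ν).real Aᶜ ≤ ∑ _k : T, 1 / L := by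
    refine (measureReal_mono hsub (measure_ne_top _ _)).trans ((measureReal_biUnion_finset_le _ _).trans ?_)
    refine Finset.sum_le_sum fun k _ => ?_
    refine (measureReal_symbolCount_deviation_le ν n k (half_pos (hD0 k))).trans ?_
    have h3 : 0 < D k ^ 2 := by have := hD0 k; positivity
    rw [div_le_div_iff₀ (by have := hD0 k; positivity) hL0, div_pow, hD k]
    have := mul_le_mul_of_nonneg_right (hl k) hL0.le
    linarith
  rw [Finset.sum_const, Finset.card_univ, Fintype.card_coe, nsmul_eq_mul, mul_one_div] at h1
  have h2 : (T.card : ℝ) / L ≤ 1 / 10 := by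
    rw [div_le_div_iff₀ hL0 (by norm_num)]
    linarith
  have h3 := probReal_compl_eq_one_sub (μ := Measure.pi fun _ : Fin n => ν) hmeas
  linarith

/-- Redundancy lower bound for an envelope class by packing the count vectors. -/
theorem le_minimaxRedundancy_envelopeClass (h1 : 1 ∉ T) {f : ℕ+ → ℝ} (hf0 : ∀ k, 0 ≤ f k)
    (hf1 : 1 ≤ f 1) {n : ℕ} (hn : 0 < n) {l : ℕ+ → ℝ} (hl0 : ∀ k, 0 < l k)
    (hlf : ∀ k ∈ T, l k ≤ n * f k) (hl1 : ∑ k ∈ T, l k ≤ n) {L : ℝ} (hL0 : 0 < L)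
    (hL : 10 * T.card ≤ L) :
    ENNReal.ofReal ((9 / 10 * (∑ k ∈ T, Real.log (l k / (4 * L)) / 2) - 1) / Real.log 2) ≤
      minimaxRedundancy (envelopeClass f) n := by
  have hn' : (0 : ℝ) < n := by exact_mod_cast hn
  set y : T → ℝ := fun k => Real.sqrt (l k / (4 * L)) with hy
  have hy0 : ∀ k, 0 < y k := fun k => Real.sqrt_pos.2 (by have := hl0 k; positivity)
  set D : T → ℝ := fun k => l k / y k with hD
  have hD0 : ∀ k, 0 < D k := fun k => div_pos (hl0 k) (hy0 k)
  have hD2 : ∀ k, D k ^ 2 = 4 * l k * L := by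
    intro k
    have := hl0 k
    rw [hD, div_pow, hy, Real.sq_sqrt (by positivity)]
    field_simp
  set M : T → ℕ := fun k => ⌈y k⌉₊ with hM
  have hM0 : ∀ k, 0 < M k := fun k => Nat.ceil_pos.2 (hy0 k)
  have : ∀ k, NeZero (M k) := fun k => ⟨(hM0 k).ne'⟩
  set r : (∀ k, Fin (M k)) → T → ℝ := fun θ k => (θ k : ℕ) * D k with hr
  have hr0 : ∀ θ k, 0 ≤ r θ k := fun θ k => mul_nonneg (Nat.cast_nonneg _) (hD0 k).le
  have hrl : ∀ θ k, r θ k ≤ l k := by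
    intro θ k
    have h2 : ((θ k : ℕ) : ℝ) ≤ y k := (Nat.lt_ceil.1 (θ k).2).le
    calc r θ k ≤ y k * D k := mul_le_mul_of_nonneg_right h2 (hD0 k).le
      _ = l k := mul_div_cancel₀ _ (hy0 k).ne'
  have hsrc : ∀ θ, ∃ ν : Measure ℕ+, IsProbabilityMeasure ν ∧
      (∀ k : T, ν.real {(k : ℕ+)} = r θ k / n) ∧
      Measure.infinitePi (fun _ : ℕ => ν) ∈ envelopeClass f := by
    intro θ
    refine exists_source_of_freq h1 hf0 hf1 (fun k => div_nonneg (hr0 θ k) hn'.le) (fun k => ?_) ?_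
    · rw [div_le_iff₀ hn', mul_comm]
      exact (hrl θ k).trans (hlf k k.2)
    · rw [← Finset.sum_div, div_le_one hn']
      refine (Finset.sum_le_sum fun k _ => hrl θ k).trans ?_
      rw [Finset.sum_coe_sort T]
      exact hl1
  choose ν hνp hνr hνf using hsrc
  have hcenter : ∀ θ, (fun k : T => (n : ℝ) * (ν θ).real {(k : ℕ+)}) = r θ := by
    intro θ
    funext k
    rw [hνr, mul_div_cancel₀ _ hn'.ne']
  have key := le_minimaxRedundancy_of_disjoint (envelopeClass f) n
    (fun θ => Measure.infinitePi fun _ : ℕ => ν θ) hνf (fun θ => countBox n (r θ) D)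
    (fun θ θ' hne => by
      obtain ⟨k, hk⟩ := Function.ne_iff.1 hne
      refine disjoint_countBox (k := k) ?_
      have h2 : (1 : ℝ) ≤ |((θ k : ℕ) : ℝ) - ((θ' k : ℕ) : ℝ)| := by
        have h3 : ((θ k : ℕ) : ℤ) - ((θ' k : ℕ) : ℤ) ≠ 0 := by
          rw [sub_ne_zero]
          exact_mod_cast fun h => hk (Fin.ext h)
        exact_mod_cast Int.one_le_abs h3
      simp only [hr]
      rw [← sub_mul, abs_mul, abs_of_pos (hD0 k)]
      exact le_mul_of_one_le_left (hD0 k).le h2)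
    (δ := 9 / 10) (fun θ => by
      rw [firstSymbols_infinitePi, ← hcenter θ]
      refine measureReal_countBox_ge (ν θ) n hL hL0 hD2 hD0 fun k => ?_
      rw [congrFun (hcenter θ) k]
      exact hrl θ k)
  refine le_trans (ENNReal.ofReal_le_ofReal ?_) key
  have hcard : ∑ k ∈ T, Real.log (l k / (4 * L)) / 2 ≤
      Real.log (Fintype.card (∀ k, Fin (M k))) := by
    rw [Fintype.card_pi, Nat.cast_prod, Real.log_prod fun k _ => by simp [(hM0 k).ne'],
      ← Finset.sum_coe_sort T]
    refine Finset.sum_le_sum fun k _ => ?_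
    rw [Fintype.card_fin, ← Real.log_sqrt (by have := hl0 k; positivity)]
    exact Real.log_le_log (hy0 k) (Nat.le_ceil _)
  have h2 : 0 < Real.log 2 := Real.log_pos one_lt_two
  gcongr

end Packing

section RedundancyBound

lemma exists_geometric_sum_le_one {α : ℝ} (hα : 0 < α) :
    ∃ k₀ : ℕ, 1 ≤ k₀ ∧ ∀ m : ℕ, ∑ j ∈ Finset.range m,
      Real.exp (-α * ((k₀ + j + 1 : ℕ) : ℝ)) ≤ 1 := by
  have hd : 0 < 1 - Real.exp (-α) := sub_pos.2 (Real.exp_lt_one_iff.2 (by linarith))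
  obtain ⟨k, hk⟩ := exists_pow_lt_of_lt_one hd (Real.exp_lt_one_iff.2 (by linarith : -α < 0))
  refine ⟨k + 1, by omega, fun m => ?_⟩
  have h1 : ∀ j ∈ Finset.range m, Real.exp (-α * ((k + 1 + j + 1 : ℕ) : ℝ)) ≤
      Real.exp (-α) ^ k * Real.exp (-α) ^ j := by
    intro j _
    rw [← pow_add, ← Real.exp_nat_mul]
    apply Real.exp_le_exp.2
    push_cast
    nlinarith
  refine (Finset.sum_le_sum h1).trans ?_
  rw [← Finset.mul_sum]
  have h2 : ∑ j ∈ Finset.range m, Real.exp (-α) ^ j ≤ (1 - Real.exp (-α))⁻¹ :=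
    sum_le_hasSum _ (fun j _ => by positivity) (hasSum_geometric_of_lt_one (Real.exp_pos _).le
      (Real.exp_lt_one_iff.2 (by linarith)))
  calc _ ≤ (1 - Real.exp (-α)) * (1 - Real.exp (-α))⁻¹ := by gcongr
    _ = 1 := mul_inv_cancel₀ hd.ne'

lemma le_sum_log_of_mul_le {α x c : ℝ} (hα : 0 < α) {m : ℕ} (hm : 0 < m) (hmx : α * m ≤ x) :
    (m : ℝ) / 2 * (x / 2 - α * (c + 1) - Real.log (40 * (x / α))) ≤
      ∑ j ∈ Finset.range m, (x - α * (c + j + 1) - Real.log (40 * m)) / 2 := by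
  have hm' : (0 : ℝ) < m := by exact_mod_cast hm
  have h1 : ∑ j ∈ Finset.range m, (j : ℝ) = m * (m - 1) / 2 := by
    have h2 := Finset.sum_range_id_mul_two m
    have h3 : ((∑ j ∈ Finset.range m, j : ℕ) : ℝ) * 2 = m * (m - 1) := by
      rw [← Nat.cast_pred hm]
      exact_mod_cast h2
    push_cast at h3
    linarith
  have h2 : ∑ j ∈ Finset.range m, (x - α * (c + j + 1) - Real.log (40 * m)) / 2 =
      m * ((x - α * (c + 1) - Real.log (40 * m)) / 2) - α / 2 * (m * (m - 1) / 2) := by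
    rw [← h1, Finset.mul_sum, ← nsmul_eq_mul, ← Finset.card_range m, ← Finset.sum_const,
      Finset.card_range, ← Finset.sum_sub_distrib]
    exact Finset.sum_congr rfl fun j _ => by ring
  have h3 : Real.log (40 * m) ≤ Real.log (40 * (x / α)) := by
    refine Real.log_le_log (by positivity) ?_
    have : (m : ℝ) ≤ x / α := by rw [le_div_iff₀ hα]; linarith
    linarith
  rw [h2]
  nlinarith [mul_le_mul_of_nonneg_left hmx hm'.le, mul_le_mul_of_nonneg_left h3 hm'.le,
    mul_pos hα hm']

lemma eventually_le_packing_exponent {α c : ℝ} (hα : 0 < α) :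
    ∀ᶠ x : ℝ in atTop, ∀ m : ℕ, x / α - 1 ≤ m →
      1 / (8 * α) * (x / Real.log 2) ^ 2 ≤ (9 / 10 * ((m : ℝ) / 2 *
        (x / 2 - α * (c + 1) - Real.log (40 * (x / α)))) - 1) / Real.log 2 := by
  have hlog : ∀ᶠ x : ℝ in atTop, Real.log x ≤ 1 / 200 * x := by
    have := Real.isLittleO_log_id_atTop.bound (by norm_num : (0 : ℝ) < 1 / 200)
    filter_upwards [this, eventually_ge_atTop 0] with x hx hx0
    rw [id, Real.norm_of_nonneg hx0] at hx
    exact (le_abs_self _).trans hx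
  filter_upwards [hlog, eventually_gt_atTop 1, eventually_ge_atTop (100 * α),
    eventually_ge_atTop (200 * (α * (c + 1) + Real.log (40 / α)))] with x h1 h2 h3 h4 m hm
  have hx : 0 < x := by linarith
  have hl : 0.6931471803 < Real.log 2 := Real.log_two_gt_d9
  have hl0 : 0 < Real.log 2 := by linarith
  have h5 : 100 ≤ x / α := by rwa [le_div_iff₀ hα]
  have h6 : 0.49 * x ≤ x / 2 - α * (c + 1) - Real.log (40 * (x / α)) := by
    have h7 : 40 * (x / α) = 40 / α * x := by ring
    rw [h7, Real.log_mul (by positivity) hx.ne']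
    linarith
  have h7 : 0.99 * (x / α) ≤ m := by linarith
  have h8 : 0.99 * (x / α) / 2 * (0.49 * x) ≤
      (m : ℝ) / 2 * (x / 2 - α * (c + 1) - Real.log (40 * (x / α))) := by gcongr
  have h9 : 100 ≤ x / α * x := by nlinarith
  have h10 : 1 / (8 * α) * (x / Real.log 2) ^ 2 = x / α * x / (8 * Real.log 2) / Real.log 2 := by
    field_simp
  rw [h10]
  refine div_le_div_of_nonneg_right ?_ hl0.le
  rw [div_le_iff₀ (by positivity)]
  have h11 : 0.2 * (x / α * x) ≤ 9 / 10 * ((m : ℝ) / 2 *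
      (x / 2 - α * (c + 1) - Real.log (40 * (x / α)))) - 1 := by linarith
  refine le_trans ?_ (mul_le_mul_of_nonneg_right h11 (by positivity))
  nlinarith

theorem eventually_le_minimaxRedundancy {α C : ℝ} (hα : 0 < α) (hC : Real.exp α ≤ C) :
    ∀ᶠ n : ℕ in atTop, ENNReal.ofReal (1 / (8 * α) * Real.logb 2 n ^ 2) ≤
      minimaxRedundancy (envelopeClass (expEnvelope α C)) n := by
  obtain ⟨k₀, hk₀, hsum⟩ := exists_geometric_sum_le_one hα
  have hC1 : 1 ≤ C := (Real.one_le_exp hα.le).trans hC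
  have htend : Tendsto (fun n : ℕ => Real.log n) atTop atTop :=
    Real.tendsto_log_atTop.comp tendsto_natCast_atTop_atTop
  filter_upwards [htend.eventually (eventually_le_packing_exponent (c := k₀) hα),
    htend.eventually (eventually_ge_atTop α), eventually_gt_atTop 0] with n hn hnα hn0
  have hn' : (0 : ℝ) < n := by exact_mod_cast hn0
  set x := Real.log n with hx
  set m : ℕ := ⌊x / α⌋₊ with hm
  have hxα : 1 ≤ x / α := by rwa [one_le_div hα]
  have hm0 : 0 < m := Nat.floor_pos.2 hxα
  have hm' : (0 : ℝ) < m := by exact_mod_cast hm0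
  have hmx : α * m ≤ x := by
    have := Nat.floor_le (zero_le_one.trans hxα)
    rw [le_div_iff₀ hα] at this
    linarith
  set e : ℕ ↪ ℕ+ := ⟨fun j => Nat.succPNat (k₀ + j), fun i j h => by
    have := Nat.succPNat_injective h
    omega⟩ with he
  have hecoe : ∀ j, ((e j : ℕ+) : ℝ) = ((k₀ + j + 1 : ℕ) : ℝ) := fun j => rfl
  have hT1 : (1 : ℕ+) ∉ (Finset.range m).map e := by
    simp only [Finset.mem_map, not_exists, not_and]
    intro j _ hj
    have h1 : ((e j : ℕ+) : ℕ) = 1 := by rw [hj]; rfl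
    have h2 : ((e j : ℕ+) : ℕ) = k₀ + j + 1 := rfl
    omega
  have hf0 : ∀ k, 0 ≤ expEnvelope α C k := fun k => le_min zero_le_one (by positivity)
  have hf1 : 1 ≤ expEnvelope α C 1 := by
    refine le_min le_rfl ?_
    have h1 : Real.exp α * Real.exp (-α * ((1 : ℕ+) : ℝ)) = 1 := by
      rw [← Real.exp_add]; simp
    rw [← h1]
    gcongr
  have key := le_minimaxRedundancy_envelopeClass hT1 hf0 hf1 hn0
    (l := fun k => n * Real.exp (-α * (k : ℝ))) (fun k => by positivity) (fun k _ => by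
      gcongr
      refine le_min (Real.exp_le_one_iff.2 ?_) (le_mul_of_one_le_left (Real.exp_pos _).le hC1)
      have : (0 : ℝ) < (k : ℝ) := by positivity
      nlinarith) (by
      rw [← Finset.mul_sum, Finset.sum_map]
      simp only [hecoe]
      exact mul_le_of_le_one_right hn'.le (hsum m)) (L := 10 * m) (by positivity) (by simp)
  refine le_trans (ENNReal.ofReal_le_ofReal ?_) key
  rw [Finset.sum_map]
  have hterm : ∀ j ∈ Finset.range m, Real.log (n * Real.exp (-α * ((e j : ℕ+) : ℝ)) /
      (4 * (10 * m))) / 2 = (x - α * (k₀ + j + 1) - Real.log (40 * m)) / 2 := by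
    intro j _
    rw [Real.log_div (by positivity) (by positivity), Real.log_mul (by positivity) (by positivity),
      Real.log_exp, hecoe]
    push_cast
    rw [← mul_assoc, show (4 : ℝ) * 10 = 40 by norm_num]
    ring
  rw [Finset.sum_congr rfl hterm]
  refine (hn m (by linarith [Nat.lt_floor_add_one (x / α)])).trans ?_
  have h2 : 0 < Real.log 2 := Real.log_pos one_lt_two
  have := le_sum_log_of_mul_le (c := k₀) hα hm0 hmx
  gcongr

end RedundancyBound

end UniversalCoding

theorem mainTheorem4 (α C : ℝ) (hα : 0 < α) (hC : Real.exp (2 * α) < C) :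
    (∃ ε : ℕ → ℝ, Tendsto ε atTop (𝓝 0) ∧ ∀ n : ℕ, 1 ≤ n →
      ((1 / (8 * α) * Real.logb 2 n ^ 2 * (1 - ε n) : ℝ) : EReal) ≤
        (UniversalCoding.minimaxRedundancy
          (UniversalCoding.envelopeClass (UniversalCoding.expEnvelope α C)) n : EReal)) ∧
    (∀ n : ℕ, 1 ≤ n →
      (UniversalCoding.minimaxRedundancy
          (UniversalCoding.envelopeClass (UniversalCoding.expEnvelope α C)) n : EReal) ≤
        UniversalCoding.minimaxRegret
          (UniversalCoding.envelopeClass (UniversalCoding.expEnvelope α C)) n) ∧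
    (∃ K : ℝ, ∀ n : ℕ, 1 ≤ n →
      UniversalCoding.minimaxRegret
          (UniversalCoding.envelopeClass (UniversalCoding.expEnvelope α C)) n ≤
        ((1 / (2 * α) * Real.logb 2 n ^ 2 + K : ℝ) : EReal)) := by
  have hCα : Real.exp α ≤ C := (Real.exp_le_exp.2 (by linarith)).trans hC.le
  have hC0 : 0 < C := (Real.exp_pos _).trans hC
  refine ⟨?_, fun n _ => ?_, UniversalCoding.exists_minimaxRegret_le hα hC0⟩
  · obtain ⟨N, hN⟩ := eventually_atTop.1
      (UniversalCoding.eventually_le_minimaxRedundancy hα hCα)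
    refine ⟨fun n => if N ≤ n then 0 else 1, ?_, fun n _ => ?_⟩
    · refine tendsto_const_nhds.congr' ?_
      filter_upwards [eventually_ge_atTop N] with n hn
      rw [if_pos hn]
    · by_cases h : N ≤ n
      · have h1 := EReal.coe_ennreal_le_coe_ennreal_iff.2 (hN n h)
        rw [EReal.coe_ennreal_ofReal, max_eq_left (by positivity)] at h1
        simpa [h] using h1
      · simpa [h] using EReal.coe_ennreal_nonneg _
  · refine UniversalCoding.minimaxRedundancy_le_minimaxRegret _ (fun P hP => hP.1) ?_ n
    refine ⟨_, UniversalCoding.infinitePi_mem_envelopeClass (ν := Measure.dirac 1) fun k => ?_⟩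
    by_cases hk : k = 1
    · subst hk
      refine measureReal_le_one.trans (le_min le_rfl ?_)
      rw [← Real.exp_zero, show (0 : ℝ) = α + -α * ((1 : ℕ+) : ℝ) by simp, Real.exp_add]
      gcongr
    · have : (Measure.dirac (1 : ℕ+)).real {k} = 0 := by
        rw [measureReal_def, Measure.dirac_apply' _ (.singleton k)]
        simp [Ne.symm hk]
      rw [this]
      exact le_min zero_le_one (by positivity)
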